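/- Let $\tilde\alpha\in\mathbb R$. For $\beta\in\mathbb R$ and $i\in\mathbb N_0$ put $$d_i(\beta)=(-1)^i\,\frac{\beta(\beta-1)\cdots(\beta-i+1)}{i!},$$ which equals $(-1)^i\frac{\Gamma(\beta+1)}{i!\,\Gamma(\beta-i+1)}$ (with $1/\Gamma=0$ at the poles of $\Gamma$) whenever $\beta$ is not a negative integer. For a complex sequence $x=(x_k)_{k=0}^\infty$ let $$(\Delta^{(\tilde\alpha)}x)_k=\sum_{i=0}^{k}d_i(\tilde\alpha)\,x_{k-i}\qquad(k\in\mathbb N_0).$$ Let $c_0$, $c$, $\ell_\infty$ be the spaces of null, convergent and bounded complex sequences with the supremum norm, and let $$c_0(\Delta^{(\tilde\alpha)})=\{x:\Delta^{(\tilde\alpha)}x\in c_0\},\qquad \ell_\infty(\Delta^{(\tilde\alpha)})=\{x:\Delta^{(\tilde\alpha)}x\in \ell_\infty\},$$ both with the norm $\|x\|=\sup_k|(\Delta^{(\tilde\alpha)}x)_k|$. For a set $X$ of sequences, a sequence space $Y$ and an infinite complex matrix $A=(a_{nk})_{n,k=0}^\infty$, write $A\in(X,Y)$ if for every $x\in X$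 all the series $A_nx=\sum_{k=0}^\infty a_{nk}x_k$ converge and $Ax=(A_nx)_{n=0}^\infty\in Y$; in this case $L_A:X\to Y$ is the linear operator $L_Ax=Ax$. Put $$\hat a_{nk}=\sum_{j=k}^\infty d_{j-k}(-\tilde\alpha)\,a_{nj},\qquad \hat\alpha_k=\lim_{n\to\infty}\hat a_{nk}.$$ Let $X$ be one of the spaces $c_0(\Delta^{(\tilde\alpha)})$ or $\ell_\infty(\Delta^{(\tilde\alpha)})$. In each of the following cases the series defining $\hat a_{nk}$ converge for all $n,k$, and in case (ii) the limits $\hat\alpha_k$ exist for all $k$. Moreover: (i) If $A\in(X,c_0)$, then $L_A$ is compact if and only if $$\lim_{r\to\infty}\Bigl(\sup_{n\ge r}\sum_{k=0}^\infty|\hat a_{nk}|\Bigr)=0.\tag{$*$}$$ (ii) If $A\in(X,c)$, then $L_A$ is compact if and only if $$\lim_{r\to\infty}\Bigl(\sup_{n\ge r}\sum_{k=0}^\infty|\hat a_{nk}-\hat\alpha_k|\Bigr)=0.$$ (iii) If $A\in(X,\ell_\infty)$ and $(*)$ holds, then $L_A$ is compact. -/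

import Mathlib

open Filter Topology
open scoped ENNReal

noncomputable section

namespace FracDiff

/-! ### The fractional difference operator -/

/-- The coefficient `(-1)^i Γ(α+1) / (i! Γ(α-i+1))`, in its product form
`(-1)^i α(α-1)⋯(α-i+1) / i!`, which makes sense for every real `α`
(for negative integers `α` the Gamma quotient has to be read as a limit).
See `coeff_eq_Gamma` for the agreement with the Gamma quotient. -/
def coeff (α : ℝ) (i : ℕ) : ℝ :=
  (-1) ^ i * (∏ l ∈ Finset.range i, (α - l)) / (i.factorial : ℝ)

theorem coeff_zero (α : ℝ) : coeff α 0 = 1 := by simp [coeff]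

theorem coeff_eq_Gamma (α : ℝ) (hα : ∀ m : ℕ, α ≠ -((m : ℝ) + 1)) (i : ℕ) :
    coeff α i =
      (-1) ^ i * Real.Gamma (α + 1) / ((i.factorial : ℝ) * Real.Gamma (α - i + 1)) := by
  have key : ∀ i : ℕ, (∏ l ∈ Finset.range i, (α - l)) =
      Real.Gamma (α + 1) / Real.Gamma (α - i + 1) := by
    intro i
    induction i with
    | zero =>
      have h : Real.Gamma (α + 1) ≠ 0 := by
        apply Real.Gamma_ne_zero
        intro m hm
        exact hα m (by linarith)
      simp [div_self h]
    | succ i ih =>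
      rw [Finset.prod_range_succ, ih]
      have e : α - ((i + 1 : ℕ) : ℝ) + 1 = α - i := by push_cast; ring
      rw [e]
      by_cases h0 : α - i = 0
      · rw [h0]; simp
      · rw [Real.Gamma_add_one h0]
        by_cases hG : Real.Gamma (α - i) = 0
        · rw [hG]; simp
        · field_simp
  rw [coeff, key i, mul_div_assoc', div_div, mul_comm (Real.Gamma (α - i + 1))]

/-- The fractional difference operator on all complex sequences,
`(Δ^(α) x)_k = ∑_{i=0}^{k} (-1)^i Γ(α+1) / (i! Γ(α-i+1)) x_{k-i}`
(terms of negative index are zero). -/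
def fracDiff (α : ℝ) : (ℕ → ℂ) →ₗ[ℂ] (ℕ → ℂ) where
  toFun x k := ∑ i ∈ Finset.range (k + 1), (coeff α i : ℂ) * x (k - i)
  map_add' x y := by
    funext k
    simp [mul_add, Finset.sum_add_distrib]
  map_smul' c x := by
    funext k
    simp only [Pi.smul_apply, smul_eq_mul, RingHom.id_apply, Finset.mul_sum]
    exact Finset.sum_congr rfl fun i _ => by ring

theorem fracDiff_apply (α : ℝ) (x : ℕ → ℂ) (k : ℕ) :
    fracDiff α x k = ∑ i ∈ Finset.range (k + 1), (coeff α i : ℂ) * x (k - i) := rfl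

theorem fracDiff_injective (α : ℝ) : Function.Injective (fracDiff α) := by
  rw [injective_iff_map_eq_zero]
  intro x hx
  funext k
  induction k using Nat.strong_induction_on with
  | _ k ih =>
    have h := congrFun hx k
    rw [fracDiff_apply, Finset.sum_range_succ'] at h
    rw [Finset.sum_eq_zero] at h
    · simpa [coeff_zero] using h
    · intro i hi
      rw [ih (k - (i + 1)) (by have := Finset.mem_range.1 hi; omega)]
      simp

/-! ### The classical sequence spaces, with the supremum norm -/

/-- The Banach space of bounded complex sequences with the supremum norm. -/
abbrev Bdd : Type := lp (fun _ : ℕ => ℂ) ∞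

/-- The space `ℓ∞` of bounded sequences. -/
def linf : Submodule ℂ Bdd := ⊤

/-- The space `c` of convergent sequences. -/
def conv : Submodule ℂ Bdd where
  carrier := {y | ∃ l : ℂ, Tendsto (fun n => y n) atTop (𝓝 l)}
  add_mem' := by
    rintro y z ⟨l, hl⟩ ⟨m, hm⟩
    exact ⟨l + m, hl.add hm⟩
  zero_mem' := ⟨0, tendsto_const_nhds⟩
  smul_mem' := by
    rintro a y ⟨l, hl⟩
    exact ⟨a * l, hl.const_mul a⟩

/-- The space `c₀` of null sequences. -/
def null : Submodule ℂ Bdd where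
  carrier := {y | Tendsto (fun n => y n) atTop (𝓝 0)}
  add_mem' := by
    intro y z hy hz
    have h : Tendsto (fun n => y n + z n) atTop (𝓝 (0 + 0)) := hy.add hz
    rw [add_zero] at h
    exact h
  zero_mem' := tendsto_const_nhds
  smul_mem' := by
    intro a y hy
    have h : Tendsto (fun n => a * y n) atTop (𝓝 (a * 0)) := hy.const_mul a
    rw [mul_zero] at h
    exact h

/-- The complex sequence `y` belongs to the sequence space `E`. -/
def InSpace (E : Submodule ℂ Bdd) (y : ℕ → ℂ) : Prop :=
  ∃ h : Memℓp y ∞, (⟨y, h⟩ : Bdd) ∈ E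

/-! ### The fractional difference sequence spaces -/

/-- The linear space `E(Δ^(α)) = {x ∈ ω : Δ^(α) x ∈ E}`. -/
def fracDomain (α : ℝ) (E : Submodule ℂ Bdd) : Submodule ℂ (ℕ → ℂ) where
  carrier := {x | InSpace E (fracDiff α x)}
  add_mem' := by
    rintro x y ⟨hx, hx'⟩ ⟨hy, hy'⟩
    show InSpace E (fracDiff α (x + y))
    rw [map_add]
    exact ⟨hx.add hy, E.add_mem hx' hy'⟩
  zero_mem' := by
    show InSpace E (fracDiff α 0)
    rw [map_zero]
    exact ⟨zero_memℓp, E.zero_mem⟩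
  smul_mem' := by
    rintro c x ⟨hx, hx'⟩
    show InSpace E (fracDiff α (c • x))
    rw [map_smul]
    exact ⟨hx.const_smul c, E.smul_mem c hx'⟩

theorem mem_fracDomain_null (α : ℝ) (x : ℕ → ℂ) :
    x ∈ fracDomain α null ↔ Tendsto (fracDiff α x) atTop (𝓝 0) := by
  constructor
  · rintro ⟨_, h⟩
    exact h
  · intro h
    exact ⟨memℓp_infty h.norm.bddAbove_range, h⟩

theorem mem_fracDomain_linf (α : ℝ) (x : ℕ → ℂ) :
    x ∈ fracDomain α linf ↔ BddAbove (Set.range fun k => ‖fracDiff α x k‖) := by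
  constructor
  · rintro ⟨h, _⟩
    exact memℓp_infty_iff.1 h
  · intro h
    exact ⟨memℓp_infty h, Submodule.mem_top⟩

/-- The space `E(Δ^(α))` as a type, to carry the norm `‖x‖ = sup_k |(Δ^(α) x)_k|`
and not the topology of coordinatewise convergence. -/
def FracSpace (α : ℝ) (E : Submodule ℂ Bdd) : Type := fracDomain α E

instance (α : ℝ) (E : Submodule ℂ Bdd) : AddCommGroup (FracSpace α E) :=
  inferInstanceAs (AddCommGroup (fracDomain α E))

instance (α : ℝ) (E : Submodule ℂ Bdd) : Module ℂ (FracSpace α E) :=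
  inferInstanceAs (Module ℂ (fracDomain α E))

/-- The sequence underlying an element of `E(Δ^(α))`. -/
def FracSpace.seq {α : ℝ} {E : Submodule ℂ Bdd} : FracSpace α E →ₗ[ℂ] (ℕ → ℂ) :=
  (fracDomain α E).subtype

theorem FracSpace.seq_mem {α : ℝ} {E : Submodule ℂ Bdd} (x : FracSpace α E) :
    x.seq ∈ fracDomain α E := Subtype.property (p := fun z => z ∈ fracDomain α E) x

/-- The operator `Δ^(α)` from `E(Δ^(α))` to the bounded sequences. -/
def FracSpace.diff {α : ℝ} {E : Submodule ℂ Bdd} : FracSpace α E →ₗ[ℂ] Bdd where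
  toFun x := ⟨fracDiff α x.seq, x.seq_mem.choose⟩
  map_add' x y := Subtype.ext (by simp; rfl)
  map_smul' c x := Subtype.ext (by simp; rfl)

theorem FracSpace.diff_injective {α : ℝ} {E : Submodule ℂ Bdd} :
    Function.Injective (FracSpace.diff : FracSpace α E →ₗ[ℂ] Bdd) := by
  intro x y h
  exact Subtype.ext (fracDiff_injective α (congrArg Subtype.val h))

instance (α : ℝ) (E : Submodule ℂ Bdd) : NormedAddCommGroup (FracSpace α E) :=
  NormedAddCommGroup.induced (FracSpace α E) Bdd FracSpace.diff FracSpace.diff_injective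

instance (α : ℝ) (E : Submodule ℂ Bdd) : NormedSpace ℂ (FracSpace α E) :=
  NormedSpace.induced ℂ (FracSpace α E) Bdd FracSpace.diff

theorem FracSpace.norm_eq {α : ℝ} {E : Submodule ℂ Bdd} (x : FracSpace α E) :
    ‖x‖ = ⨆ k, ‖fracDiff α x.seq k‖ :=
  lp.norm_eq_ciSup (FracSpace.diff x)

/-! ### Infinite matrices -/

/-- Convergence of the series `∑_{k=0}^∞ f k`, as the limit of its partial sums. -/
def SeriesConverges (f : ℕ → ℂ) : Prop := Summable f (SummationFilter.conditional ℕ)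

/-- The value of the series `∑_{k=0}^∞ f k`, as the limit of its partial sums. -/
def seriesSum (f : ℕ → ℂ) : ℂ := ∑'[SummationFilter.conditional ℕ] k, f k

theorem seriesConverges_iff (f : ℕ → ℂ) :
    SeriesConverges f ↔ ∃ s, Tendsto (fun m => ∑ k ∈ Finset.range m, f k) atTop (𝓝 s) := by
  simp only [SeriesConverges, Summable, HasSum, SummationFilter.conditional_filter_eq_map_range,
    tendsto_map'_iff, Function.comp_def]

theorem seriesSum_eq {f : ℕ → ℂ} {s : ℂ}
    (h : Tendsto (fun m => ∑ k ∈ Finset.range m, f k) atTop (𝓝 s)) : seriesSum f = s := by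
  apply HasSum.tsum_eq
  simpa only [HasSum, SummationFilter.conditional_filter_eq_map_range,
    tendsto_map'_iff, Function.comp_def] using h

/-- The sequence `A x = (∑_k a_{nk} x_k)_n`. -/
def matApply (A : ℕ → ℕ → ℂ) (x : ℕ → ℂ) : ℕ → ℂ :=
  fun n => seriesSum fun k => A n k * x k

/-- `A ∈ (X, F)` for `X = E(Δ^(α))`: for every `x ∈ X` all the series `∑_k a_{nk} x_k` converge
and the sequence `A x` belongs to `F`. -/
def MatClass (α : ℝ) (E F : Submodule ℂ Bdd) (A : ℕ → ℕ → ℂ) : Prop :=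
  ∀ x ∈ fracDomain α E,
    (∀ n, SeriesConverges fun k => A n k * x k) ∧ InSpace F (matApply A x)

/-- The operator `L_A : E(Δ^(α)) → F`, `L_A x = A x`, of a matrix `A ∈ (E(Δ^(α)), F)`. -/
def matOp {α : ℝ} {E F : Submodule ℂ Bdd} {A : ℕ → ℕ → ℂ} (h : MatClass α E F A) :
    FracSpace α E →ₗ[ℂ] F where
  toFun x := ⟨⟨matApply A x.seq, (h x.seq x.seq_mem).2.choose⟩,
    (h x.seq x.seq_mem).2.choose_spec⟩
  map_add' x y := by
    apply Subtype.ext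
    apply Subtype.ext
    funext n
    show matApply A (FracSpace.seq (x + y)) n =
      matApply A (FracSpace.seq x) n + matApply A (FracSpace.seq y) n
    have hx := (h x.seq x.seq_mem).1 n
    have hy := (h y.seq y.seq_mem).1 n
    simp only [matApply, seriesSum, map_add, Pi.add_apply, mul_add]
    exact Summable.tsum_add hx hy
  map_smul' c x := by
    apply Subtype.ext
    apply Subtype.ext
    funext n
    show matApply A (FracSpace.seq (c • x)) n = c * matApply A (FracSpace.seq x) n
    have hx := (h x.seq x.seq_mem).1 n
    simp only [matApply, seriesSum, map_smul, Pi.smul_apply, smul_eq_mul]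
    rw [← Summable.tsum_mul_left c hx]
    congr 1
    funext k
    ring

/-- The terms, in the variable `i = j - k`, of the series
`∑_{j=k}^∞ (-1)^{j-k} Γ(-α+1) / ((j-k)! Γ(-α-j+k+1)) a_{nj}` that defines `â_{nk}`. -/
def hatTerm (α : ℝ) (A : ℕ → ℕ → ℂ) (n k i : ℕ) : ℂ :=
  (coeff (-α) i : ℂ) * A n (k + i)

/-- The matrix `Â = (â_{nk})`. -/
def hat (α : ℝ) (A : ℕ → ℕ → ℂ) (n k : ℕ) : ℂ := seriesSum (hatTerm α A n k)

/-- The series that define the entries of `Â` converge. -/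
def HatConverges (α : ℝ) (A : ℕ → ℕ → ℂ) : Prop :=
  ∀ n k, SeriesConverges (hatTerm α A n k)

/-- The sequence of the limits `α̂_k = lim_n â_{nk}`. -/
def hatLim (α : ℝ) (A : ℕ → ℕ → ℂ) (k : ℕ) : ℂ := limUnder atTop fun n => hat α A n k

end FracDiff

end

/-! The coefficient series of Δ^(α) and Δ^(-α) are inverse power series, so Δ^(α) maps X
isometrically onto E = c₀ or ℓ∞. Everything is transported to E, where A acts as Â: (Ax)_n = ∑_k
â_{nk} (Δ^(α)x)_k (`MatClass.matApply_eq_tsum`). Summation by parts (`sum_mul_fracDiff_neg`) only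
presents a row of A as the limit of a triangular array whose entries tend to â_{nk}. The uniform
boundedness principle on c₀ bounds the array in ℓ¹, which gives the formula for null sequences. On
bounded sequences mass could still escape to infinity; Schur's theorem
(`eq_zero_of_tendsto_tsum_mul`), proved by Baire category, excludes this.

The ℓ¹ distance of two rows of Â bounds the distance of the corresponding coordinate functionals of
L_A. If the rows converge in ℓ¹, then L_A is a norm limit of finite-rank operators
(`isCompactOperator_of_tendsto_coord`). Conversely, a compact set of convergent sequences converges
at a uniform rate (`exists_uniform_cauchy_of_isCompact`), and testing on finitely supported
sequences turns this rate into an ℓ¹ estimate. In (i) and (iii) the limit row is 0; the converse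
uses that images converge, hence (iii) has one direction only. -/

namespace FracDiff

/-! ### Pointwise convergent sequences of row functionals -/

/-- A complex number of modulus at most one that rotates `z` to its modulus. -/
theorem exists_norm_le_one_mul_eq_norm (z : ℂ) : ∃ c : ℂ, ‖c‖ ≤ 1 ∧ z * c = (‖z‖ : ℂ) := by
  refine ⟨(starRingEnd ℂ) z / ‖z‖, ?_, ?_⟩
  · rw [norm_div, RCLike.norm_conj, Complex.norm_real, norm_norm]
    exact div_self_le_one _
  · by_cases hz : z = 0
    · simp [hz]
    · have : (‖z‖ : ℂ) ≠ 0 := by simpa using hz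
      rw [mul_div_assoc', Complex.mul_conj', div_eq_iff this, sq]

/-- Duality of ℓ¹ and ℓ∞ on a finite section, tested with the rotations of the entries. The test
sequences vanish off the section so that they are null and hence available for either choice of E.
-/
theorem sum_norm_le_of_forall_norm_sum_mul_le {s : Finset ℕ} {v : ℕ → ℂ} {C : ℝ}
    (h : ∀ y : ℕ → ℂ, (∀ k, ‖y k‖ ≤ 1) → (∀ k ∉ s, y k = 0) → ‖∑ k ∈ s, v k * y k‖ ≤ C) :
    ∑ k ∈ s, ‖v k‖ ≤ C := by
  choose c hc hvc using fun k => exists_norm_le_one_mul_eq_norm (v k)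
  have := h (fun k => if k ∈ s then c k else 0)
    (fun k => by
      split_ifs
      · exact hc k
      · simp)
    (fun k hk => by simp [hk])
  rw [Finset.sum_congr rfl (g := fun k => ((‖v k‖ : ℝ) : ℂ))
    (fun k hk => by simp only [hk, if_true, hvc]), ← Complex.ofReal_sum, Complex.norm_real,
    Real.norm_of_nonneg (Finset.sum_nonneg fun _ _ => norm_nonneg _)] at this
  exact this

theorem isClosed_null : IsClosed (null : Set Bdd) := by
  rw [← isSeqClosed_iff_isClosed]
  intro y z hy hz
  show Tendsto (fun n => z n) atTop (𝓝 0)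
  rw [Metric.tendsto_atTop] at hz ⊢
  intro ε hε
  obtain ⟨N, hN⟩ := hz (ε / 2) (half_pos hε)
  have hyN : Tendsto (fun n => y N n) atTop (𝓝 0) := hy N
  obtain ⟨M, hM⟩ := Metric.tendsto_atTop.1 hyN (ε / 2) (half_pos hε)
  refine ⟨M, fun n hn => ?_⟩
  have h1 : ‖(y N - z) n‖ ≤ ‖y N - z‖ := lp.norm_apply_le_norm ENNReal.top_ne_zero _ n
  have h2 := hN N le_rfl
  have h3 := hM n hn
  rw [dist_eq_norm] at h2
  have h4 : dist (z n) (y N n) ≤ ‖y N - z‖ := by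
    rw [dist_comm, dist_eq_norm]
    exact h1
  linarith [dist_triangle (z n) (y N n) 0]

theorem isClosed_conv : IsClosed (conv : Set Bdd) := by
  rw [← isSeqClosed_iff_isClosed]
  intro y z hy hz
  show ∃ l, Tendsto (fun n => z n) atTop (𝓝 l)
  apply cauchySeq_tendsto_of_complete
  rw [Metric.cauchySeq_iff']
  rw [Metric.tendsto_atTop] at hz
  intro ε hε
  obtain ⟨N, hN⟩ := hz (ε / 3) (by positivity)
  obtain ⟨l, hl⟩ : ∃ l, Tendsto (fun n => y N n) atTop (𝓝 l) := hy N
  obtain ⟨M, hM⟩ := Metric.cauchySeq_iff'.1 hl.cauchySeq (ε / 3) (by positivity)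
  refine ⟨M, fun n hn => ?_⟩
  have h2 := hN N le_rfl
  rw [dist_eq_norm] at h2
  have h4 : ∀ n, dist (y N n) (z n) ≤ ‖y N - z‖ := fun n => by
    rw [dist_eq_norm]
    exact lp.norm_apply_le_norm ENNReal.top_ne_zero (y N - z) n
  have h3 := hM n hn
  have h5 := h4 n
  rw [dist_comm] at h5
  linarith [dist_triangle4 (z n) (y N n) (y N M) (z M), h4 M]

theorem null_le_conv : null ≤ conv := fun _ hy => ⟨0, hy⟩

/-- Coordinate functionals on the bounded sequences. -/
noncomputable def coord (k : ℕ) : Bdd →L[ℂ] ℂ :=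
  LinearMap.mkContinuous
    { toFun := fun y => y k
      map_add' := fun _ _ => rfl
      map_smul' := fun _ _ => rfl } 1
    (fun y => by
      rw [one_mul]
      exact lp.norm_apply_le_norm ENNReal.top_ne_zero y k)

theorem coord_apply (k : ℕ) (y : Bdd) : coord k y = y k := rfl

/-- The uniform boundedness principle for triangular matrices acting on null sequences. -/
theorem exists_sum_norm_le_of_tendsto_on_null {w : ℕ → ℕ → ℂ}
    (hw : ∀ y : ℕ → ℂ, Tendsto y atTop (𝓝 0) →
      ∃ l, Tendsto (fun m => ∑ k ∈ Finset.range m, w m k * y k) atTop (𝓝 l)) :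
    ∃ C, ∀ m, ∑ k ∈ Finset.range m, ‖w m k‖ ≤ C := by
  have : CompleteSpace null := isClosed_null.completeSpace_coe
  let g : ℕ → null →L[ℂ] ℂ := fun m =>
    (∑ k ∈ Finset.range m, w m k • coord k).comp null.subtypeL
  have hg : ∀ m (y : null), g m y = ∑ k ∈ Finset.range m, w m k * (y : Bdd) k := fun m y => by
    simp [g, coord_apply]
  obtain ⟨C, hC⟩ := banach_steinhaus (g := g) (fun y => by
    obtain ⟨l, hl⟩ := hw (fun k => (y : Bdd) k) y.2
    obtain ⟨C, hC⟩ := hl.norm.bddAbove_range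
    exact ⟨C, fun m => by
      rw [hg]
      exact hC ⟨m, rfl⟩⟩)
  refine ⟨C, fun m => sum_norm_le_of_forall_norm_sum_mul_le fun y hy1 hy0 => ?_⟩
  have hmem : Memℓp y ∞ := memℓp_infty ⟨1, by rintro _ ⟨k, rfl⟩; exact hy1 k⟩
  have hnull : (⟨y, hmem⟩ : Bdd) ∈ null := by
    show Tendsto y atTop (𝓝 0)
    refine tendsto_const_nhds.congr' ?_
    filter_upwards [eventually_ge_atTop m] with k hk
    exact (hy0 k (by simpa using hk)).symm
  have h1 := (g m).le_of_opNorm_le (hC m) ⟨⟨y, hmem⟩, hnull⟩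
  rw [hg] at h1
  refine h1.trans ?_
  have h2 : ‖(⟨⟨y, hmem⟩, hnull⟩ : null)‖ ≤ 1 :=
    lp.norm_le_of_forall_le (f := (⟨y, hmem⟩ : Bdd)) zero_le_one hy1
  have hC0 : 0 ≤ C := (norm_nonneg (g 0)).trans (hC 0)
  nlinarith

theorem sum_norm_le_of_tendsto {w : ℕ → ℕ → ℂ} {v : ℕ → ℂ} {C : ℝ}
    (hC : ∀ m, ∑ k ∈ Finset.range m, ‖w m k‖ ≤ C)
    (hv : ∀ k, Tendsto (fun m => w m k) atTop (𝓝 (v k))) (p : ℕ) :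
    ∑ k ∈ Finset.range p, ‖v k‖ ≤ C := by
  refine le_of_tendsto (tendsto_finsetSum (Finset.range p) fun k _ => (hv k).norm) ?_
  filter_upwards [eventually_ge_atTop p] with m hm
  exact (Finset.sum_le_sum_of_subset_of_nonneg (Finset.range_mono hm)
    fun _ _ _ => norm_nonneg _).trans (hC m)

/-- The block p ≤ k < m contributes at most C times the supremum of the tail of y, uniformly in m,
so the limits in m and p may be exchanged. This needs y to be null, not merely bounded. -/
theorem tendsto_sum_range_of_tendsto_on_null {w : ℕ → ℕ → ℂ} {v : ℕ → ℂ} {C : ℝ}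
    (hC : ∀ m, ∑ k ∈ Finset.range m, ‖w m k‖ ≤ C)
    (hv : ∀ k, Tendsto (fun m => w m k) atTop (𝓝 (v k))) {y : ℕ → ℂ} {l : ℂ}
    (hy : Tendsto y atTop (𝓝 0))
    (hl : Tendsto (fun m => ∑ k ∈ Finset.range m, w m k * y k) atTop (𝓝 l)) :
    Tendsto (fun p => ∑ k ∈ Finset.range p, v k * y k) atTop (𝓝 l) := by
  have hC0 : 0 ≤ C := by simpa using hC 0
  rw [Metric.tendsto_atTop]
  intro ε hε
  -- Dividing by C + 1 instead of C allows C = 0.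
  obtain ⟨P, hP⟩ := Metric.tendsto_atTop.1 hy (ε / (C + 1) / 2) (by positivity)
  refine ⟨P, fun p hp => ?_⟩
  have hlim : Tendsto (fun m => ‖∑ k ∈ Finset.range p, w m k * y k
      - ∑ k ∈ Finset.range m, w m k * y k‖) atTop
      (𝓝 ‖∑ k ∈ Finset.range p, v k * y k - l‖) :=
    ((tendsto_finsetSum _ fun k _ => (hv k).mul_const (y k)).sub hl).norm
  rw [dist_eq_norm]
  have hle : ‖∑ k ∈ Finset.range p, v k * y k - l‖ ≤ C * (ε / (C + 1) / 2) := by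
    refine le_of_tendsto hlim ?_
    filter_upwards [eventually_ge_atTop p] with m hm
    rw [norm_sub_rev, ← Finset.sum_Ico_eq_sub _ hm]
    calc ‖∑ k ∈ Finset.Ico p m, w m k * y k‖
        ≤ ∑ k ∈ Finset.Ico p m, ‖w m k‖ * (ε / (C + 1) / 2) := by
          refine norm_sum_le_of_le _ fun k hk => ?_
          rw [norm_mul]
          have := hP k (hp.trans (Finset.mem_Ico.1 hk).1)
          rw [dist_zero_right] at this
          exact mul_le_mul_of_nonneg_left this.le (norm_nonneg _)
      _ ≤ C * (ε / (C + 1) / 2) := by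
          rw [← Finset.sum_mul]
          refine mul_le_mul_of_nonneg_right ((Finset.sum_le_sum_of_subset_of_nonneg ?_
            fun _ _ _ => norm_nonneg _).trans (hC m)) (by positivity)
          intro k hk
          exact Finset.mem_range.2 (Finset.mem_Ico.1 hk).2
  have : C * (ε / (C + 1) / 2) < ε := by
    have h : C * (ε / (C + 1) / 2) = (C / (C + 1)) * (ε / 2) := by ring
    have h' : C / (C + 1) ≤ 1 := (div_le_one (by positivity)).2 (by linarith)
    rw [h]
    nlinarith
  linarith

theorem summable_mul_of_bounded {v y : ℕ → ℂ} {M : ℝ} (hv : Summable fun k => ‖v k‖)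
    (hy : ∀ k, ‖y k‖ ≤ M) : Summable fun k => v k * y k := by
  refine Summable.of_norm_bounded (hv.mul_right M) fun k => ?_
  rw [norm_mul]
  exact mul_le_mul_of_nonneg_left (hy k) (norm_nonneg _)

/-- Schur's theorem: a sequence in `ℓ¹` that converges to zero coordinatewise and converges on
every bounded sequence converges to zero on every bounded sequence. -/
theorem eq_zero_of_tendsto_tsum_mul {u : ℕ → ℕ → ℂ} (hu : ∀ m, Summable fun k => ‖u m k‖)
    (hu0 : ∀ k, Tendsto (fun m => u m k) atTop (𝓝 0))
    (hconv : ∀ y : ℕ → ℂ, (∀ k, ‖y k‖ ≤ 1) →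
      ∃ l, Tendsto (fun m => ∑' k, u m k * y k) atTop (𝓝 l))
    {y : ℕ → ℂ} (hy : ∀ k, ‖y k‖ ≤ 1) {l : ℂ}
    (hl : Tendsto (fun m => ∑' k, u m k * y k) atTop (𝓝 l)) : l = 0 := by
  have hsum : ∀ m (z : ℕ → ℂ), (∀ k, ‖z k‖ ≤ 1) → Summable fun k => u m k * z k :=
    fun m z hz => summable_mul_of_bounded (hu m) hz
  -- The unit ball of ℓ∞ with the product topology is a Baire space, and its open sets restrict only
  -- finitely many coordinates.
  let f : ℕ → (ℕ → Metric.closedBall (0 : ℂ) 1) → ℂ := fun m z => ∑' k, u m k * (z k : ℂ)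
  have hball : ∀ (z : ℕ → Metric.closedBall (0 : ℂ) 1) k, ‖(z k : ℂ)‖ ≤ 1 := fun z k => by
    exact mem_closedBall_zero_iff.1 (z k).2
  have hf : ∀ m, Continuous (f m) := fun m => by
    refine continuous_tsum (fun k => by fun_prop) (hu m) fun k z => ?_
    rw [norm_mul]
    exact mul_le_of_le_one_right (norm_nonneg _) (hball z k)
  rw [← norm_le_zero_iff]
  refine le_of_forall_pos_le_add fun ε hε => ?_
  rw [zero_add]
  let S : ℕ → Set (ℕ → Metric.closedBall (0 : ℂ) 1) := fun N =>
    {z | ∀ m ≥ N, ‖f N z - f m z‖ ≤ ε / 3}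
  have hSc : ∀ N, IsClosed (S N) := fun N => by
    have : S N = ⋂ m, ⋂ _ : m ≥ N, {z | ‖f N z - f m z‖ ≤ ε / 3} := by
      ext z
      simp [S]
    rw [this]
    exact isClosed_iInter fun m => isClosed_iInter fun _ =>
      isClosed_le ((hf N).sub (hf m)).norm continuous_const
  have hSU : ⋃ N, S N = Set.univ := by
    refine Set.eq_univ_of_forall fun z => ?_
    obtain ⟨l', hl'⟩ := hconv (fun k => z k) (hball z)
    obtain ⟨N, hN⟩ := Metric.cauchySeq_iff'.1 hl'.cauchySeq (ε / 3) (by positivity)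
    refine Set.mem_iUnion.2 ⟨N, fun m hm => ?_⟩
    have := hN m hm
    rw [dist_comm, dist_eq_norm] at this
    exact this.le
  -- Some `S N` contains a cylinder: all sequences that agree with `z₀` on the finite set `I`.
  obtain ⟨N, z₀, hz₀⟩ := nonempty_interior_of_iUnion_of_closed hSc hSU
  obtain ⟨I, V, hV, hIV⟩ := isOpen_pi_iff.1 isOpen_interior z₀ hz₀
  have hag : ∀ z : ℕ → Metric.closedBall (0 : ℂ) 1, (∀ k ∈ I, z k = z₀ k) → z ∈ S N :=
    fun z hz => interior_subset (hIV fun k hk => by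
      rw [hz k hk]
      exact (hV k hk).2)
  have htail : ∀ᶠ p in atTop, ∑' k, ‖u N (k + p)‖ < ε / 3 :=
    (tendsto_sum_nat_add fun k => ‖u N k‖).eventually_lt_const (by positivity)
  obtain ⟨p, hp, hpI⟩ := (htail.and (eventually_ge_atTop (I.sup id + 1))).exists
  have hI : ∀ k ∈ I, k < p := fun k hk =>
    lt_of_lt_of_le (Nat.lt_succ_of_le (Finset.le_sup (f := id) hk)) hpI
  -- Both points lie in the cylinder and differ by the tail of y from p on. For the row N that tail
  -- is small by the choice of p; membership in `S N` carries this to all later rows, and the first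
  -- p terms vanish in the limit.
  let z₁ : ℕ → Metric.closedBall (0 : ℂ) 1 := fun k =>
    if k < p then z₀ k else ⟨y k, by simpa using hy k⟩
  let z₂ : ℕ → Metric.closedBall (0 : ℂ) 1 := fun k =>
    if k < p then z₀ k else ⟨0, by simp⟩
  have hz₁ : z₁ ∈ S N := hag _ fun k hk => by simp [z₁, hI k hk]
  have hz₂ : z₂ ∈ S N := hag _ fun k hk => by simp [z₂, hI k hk]
  have hdiff : ∀ m, f m z₁ - f m z₂ = ∑' k, u m k * y k - ∑ k ∈ Finset.range p, u m k * y k := by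
    intro m
    show (∑' k, u m k * (z₁ k : ℂ)) - (∑' k, u m k * (z₂ k : ℂ)) = _
    rw [← (hsum m _ (hball z₁)).tsum_sub (hsum m _ (hball z₂)),
      ← (hsum m y hy).sum_add_tsum_nat_add p, add_sub_cancel_left,
      ← ((hsum m _ (hball z₁)).sub (hsum m _ (hball z₂))).sum_add_tsum_nat_add p,
      Finset.sum_eq_zero, zero_add]
    · refine tsum_congr fun k => ?_
      simp [z₁, z₂]
    · intro k hk
      simp [z₁, z₂, Finset.mem_range.1 hk]
  have hN : ‖f N z₁ - f N z₂‖ ≤ ε / 3 := by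
    rw [hdiff, ← (hsum N y hy).sum_add_tsum_nat_add p, add_sub_cancel_left]
    refine (tsum_of_norm_bounded (((summable_nat_add_iff p).2 (hu N)).hasSum) fun k => ?_).trans
      hp.le
    rw [norm_mul]
    exact mul_le_of_le_one_right (norm_nonneg _) (hy _)
  have hlim : Tendsto (fun m => ‖f m z₁ - f m z₂‖) atTop (𝓝 ‖l‖) := by
    have h0 : Tendsto (fun m => ∑ k ∈ Finset.range p, u m k * y k) atTop (𝓝 0) := by
      simpa using tendsto_finsetSum (Finset.range p) fun k _ => (hu0 k).mul_const (y k)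
    simp only [hdiff]
    simpa using (hl.sub h0).norm
  refine le_of_tendsto hlim ?_
  filter_upwards [eventually_ge_atTop N] with m hm
  have h1 := hz₁ m hm
  have h2 := hz₂ m hm
  have h3 : f m z₁ - f m z₂ = (f N z₁ - f N z₂) - (f N z₁ - f m z₁) + (f N z₂ - f m z₂) := by ring
  rw [h3]
  linarith [norm_add_le ((f N z₁ - f N z₂) - (f N z₁ - f m z₁)) (f N z₂ - f m z₂),
    norm_sub_le (f N z₁ - f N z₂) (f N z₁ - f m z₁)]

theorem eq_zero_of_tendsto_tsum_mul_of_bounded {u : ℕ → ℕ → ℂ}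
    (hu : ∀ m, Summable fun k => ‖u m k‖)
    (hu0 : ∀ k, Tendsto (fun m => u m k) atTop (𝓝 0))
    (hconv : ∀ y : ℕ → ℂ, (∀ k, ‖y k‖ ≤ 1) →
      ∃ l, Tendsto (fun m => ∑' k, u m k * y k) atTop (𝓝 l))
    {y : ℕ → ℂ} {M : ℝ} (hM : 0 < M) (hy : ∀ k, ‖y k‖ ≤ M) {l : ℂ}
    (hl : Tendsto (fun m => ∑' k, u m k * y k) atTop (𝓝 l)) : l = 0 := by
  have hM' : (M : ℂ) ≠ 0 := by exact_mod_cast hM.ne'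
  have h := eq_zero_of_tendsto_tsum_mul hu hu0 hconv (y := fun k => y k * (M : ℂ)⁻¹)
    (l := l * (M : ℂ)⁻¹)
    (fun k => by
      rw [norm_mul, norm_inv, Complex.norm_real, Real.norm_of_nonneg hM.le,
        ← div_eq_mul_inv, div_le_one hM]
      exact hy k)
    (by
      simp only [← mul_assoc, tsum_mul_right]
      exact hl.mul_const _)
  simpa [hM'] using h

/-! ### Inversion of the fractional difference operator -/

/-- Makes the Chu–Vandermonde identity for generalized binomial coefficients available; at α + (-α)
= 0 it yields the inversion. -/
theorem coeff_eq_choose (α : ℝ) (i : ℕ) : coeff α i = (-1) ^ i * Ring.choose α i := by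
  have h : ∏ l ∈ Finset.range i, (α - l) = (descPochhammer ℤ i).smeval α := by
    induction i with
    | zero => simp
    | succ i ih =>
      rw [Finset.prod_range_succ, ih, descPochhammer_succ_right, Polynomial.smeval_mul]
      simp [Polynomial.smeval_natCast]
  rw [coeff, Ring.choose_eq_smul, h, smul_eq_mul]
  ring

theorem sum_antidiagonal_coeff_mul_coeff_neg (α : ℝ) (n : ℕ) :
    ∑ p ∈ Finset.HasAntidiagonal.antidiagonal n, coeff α p.1 * coeff (-α) p.2 =
      if n = 0 then 1 else 0 := by
  have h := Ring.add_choose_eq n (Commute.all α (-α))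
  rw [add_neg_cancel, Ring.choose_zero_ite] at h
  have h' : ∑ p ∈ Finset.HasAntidiagonal.antidiagonal n, coeff α p.1 * coeff (-α) p.2 =
      (-1) ^ n * ∑ p ∈ Finset.HasAntidiagonal.antidiagonal n,
        Ring.choose α p.1 * Ring.choose (-α) p.2 := by
    rw [Finset.mul_sum]
    refine Finset.sum_congr rfl fun p hp => ?_
    rw [coeff_eq_choose, coeff_eq_choose, ← Finset.HasAntidiagonal.mem_antidiagonal.1 hp, pow_add]
    ring
  rw [h', ← h]
  split_ifs with h0 <;> simp [h0]

/-- The generating function of the coefficients of `Δ^(α)`. -/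
noncomputable def coeffSeries (α : ℝ) : PowerSeries ℂ := PowerSeries.mk fun i => (coeff α i : ℂ)

theorem coeffSeries_mul_neg (α : ℝ) : coeffSeries α * coeffSeries (-α) = 1 := by
  ext n
  rw [PowerSeries.coeff_mul, PowerSeries.coeff_one]
  simp only [coeffSeries, PowerSeries.coeff_mk]
  have := congrArg (fun t : ℝ => (t : ℂ)) (sum_antidiagonal_coeff_mul_coeff_neg α n)
  push_cast at this
  rw [this]
  split_ifs <;> simp

theorem mk_fracDiff (α : ℝ) (x : ℕ → ℂ) :
    PowerSeries.mk (fracDiff α x) = coeffSeries α * PowerSeries.mk x := by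
  ext n
  rw [PowerSeries.coeff_mul, PowerSeries.coeff_mk, fracDiff_apply,
    Finset.Nat.sum_antidiagonal_eq_sum_range_succ_mk]
  simp [coeffSeries]

theorem fracDiff_fracDiff_neg (α : ℝ) (y : ℕ → ℂ) : fracDiff α (fracDiff (-α) y) = y := by
  have h : PowerSeries.mk (fracDiff α (fracDiff (-α) y)) = PowerSeries.mk y := by
    rw [mk_fracDiff, mk_fracDiff, ← mul_assoc, coeffSeries_mul_neg, one_mul]
  funext k
  simpa using congrArg (PowerSeries.coeff k) h

theorem fracDiff_neg_fracDiff (α : ℝ) (y : ℕ → ℂ) : fracDiff (-α) (fracDiff α y) = y :=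
  fracDiff_injective α (fracDiff_fracDiff_neg α _)

/-- Summation by parts for a row of `A` against the inverse of `Δ^(α)`. -/
theorem sum_mul_fracDiff_neg (α : ℝ) (A : ℕ → ℕ → ℂ) (n : ℕ) (y : ℕ → ℂ) (m : ℕ) :
    ∑ j ∈ Finset.range m, A n j * fracDiff (-α) y j =
      ∑ k ∈ Finset.range m, (∑ i ∈ Finset.range (m - k), hatTerm α A n k i) * y k := by
  simp only [Finset.sum_mul]
  rw [← Finset.sum_range_diag_flip m fun k i => hatTerm α A n k i * y k]
  refine Finset.sum_congr rfl fun j _ => ?_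
  rw [fracDiff_apply, Finset.mul_sum, ← Finset.sum_flip]
  refine Finset.sum_congr rfl fun k hk => ?_
  have hk' : k ≤ j := Nat.lt_succ_iff.1 (Finset.mem_range.1 hk)
  rw [hatTerm, Nat.sub_sub_self hk', Nat.add_sub_cancel' hk']
  ring

/-! ### Rows of matrices in `(E(Δ^(α)), F)` -/

theorem tendsto_seriesSum {f : ℕ → ℂ} (h : SeriesConverges f) :
    Tendsto (fun m => ∑ k ∈ Finset.range m, f k) atTop (𝓝 (seriesSum f)) := by
  obtain ⟨s, hs⟩ := (seriesConverges_iff f).1 h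
  rwa [seriesSum_eq hs]

theorem fracDomain_mono (α : ℝ) {E E' : Submodule ℂ Bdd} (hE : E ≤ E') :
    fracDomain α E ≤ fracDomain α E' := fun _ ⟨hx, hx'⟩ => ⟨hx, hE hx'⟩

theorem fracDiff_neg_mem_fracDomain {α : ℝ} {E : Submodule ℂ Bdd} (hE : null ≤ E) {y : ℕ → ℂ}
    (hy : Tendsto y atTop (𝓝 0)) : fracDiff (-α) y ∈ fracDomain α E :=
  fracDomain_mono α hE ((mem_fracDomain_null α _).2 (by rwa [fracDiff_fracDiff_neg]))

section Rows

variable {α : ℝ} {E F : Submodule ℂ Bdd} {A : ℕ → ℕ → ℂ}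

theorem MatClass.tendsto_sum (h : MatClass α E F A) {x : ℕ → ℂ} (hx : x ∈ fracDomain α E)
    (n : ℕ) :
    Tendsto (fun m => ∑ k ∈ Finset.range m,
      (∑ i ∈ Finset.range (m - k), hatTerm α A n k i) * fracDiff α x k) atTop
      (𝓝 (matApply A x n)) := by
  have := tendsto_seriesSum ((h x hx).1 n)
  refine this.congr fun m => ?_
  rw [← sum_mul_fracDiff_neg, fracDiff_neg_fracDiff]

theorem tendsto_single (k : ℕ) (c : ℂ) :
    Tendsto (Pi.single k c : ℕ → ℂ) atTop (𝓝 0) := by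
  refine tendsto_const_nhds.congr' ?_
  filter_upwards [eventually_gt_atTop k] with j hj
  rw [Pi.single_eq_of_ne hj.ne']

/-- For the preimage of a unit vector under Δ^(α), the partial sums of the row of A are exactly the
partial sums of the series for â_{nk}. -/
theorem MatClass.tendsto_sum_hatTerm (hE : null ≤ E) (h : MatClass α E F A) (n k : ℕ) :
    Tendsto (fun m => ∑ i ∈ Finset.range m, hatTerm α A n k i) atTop
      (𝓝 (matApply A (fracDiff (-α) (Pi.single k 1)) n)) := by
  -- The shift by k + 1 keeps the index k inside the range of summation; it leaves m + 1 terms,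
  -- hence the further shift by one.
  have h1 := (h.tendsto_sum (fracDiff_neg_mem_fracDomain hE (tendsto_single k 1)) n).comp
    (tendsto_add_atTop_nat (k + 1))
  rw [← tendsto_add_atTop_iff_nat 1]
  refine h1.congr fun m => ?_
  rw [Function.comp_apply, fracDiff_fracDiff_neg, Finset.sum_eq_single k]
  · rw [Pi.single_eq_same, mul_one, show m + (k + 1) - k = m + 1 by omega]
  · intro j _ hj
    rw [Pi.single_eq_of_ne hj, mul_zero]
  · intro hk
    exact absurd (Finset.mem_range.2 (by omega)) hk

theorem MatClass.hatConverges (hE : null ≤ E) (h : MatClass α E F A) : HatConverges α A :=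
  fun n k => (seriesConverges_iff _).2 ⟨_, h.tendsto_sum_hatTerm hE n k⟩

theorem MatClass.hat_eq (hE : null ≤ E) (h : MatClass α E F A) (n k : ℕ) :
    hat α A n k = matApply A (fracDiff (-α) (Pi.single k 1)) n :=
  seriesSum_eq (h.tendsto_sum_hatTerm hE n k)

theorem MatClass.tendsto_sum_hatTerm_sub (hE : null ≤ E) (h : MatClass α E F A) (n k : ℕ) :
    Tendsto (fun m => ∑ i ∈ Finset.range (m - k), hatTerm α A n k i) atTop
      (𝓝 (hat α A n k)) := by
  rw [h.hat_eq hE]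
  exact (h.tendsto_sum_hatTerm hE n k).comp (tendsto_sub_atTop_nat k)

theorem MatClass.matApply_of_support (hE : null ≤ E) (h : MatClass α E F A) (n p : ℕ)
    {y : ℕ → ℂ} (hy : ∀ k ∉ Finset.range p, y k = 0) :
    matApply A (fracDiff (-α) y) n = ∑ k ∈ Finset.range p, hat α A n k * y k := by
  have hy0 : Tendsto y atTop (𝓝 0) := by
    refine tendsto_const_nhds.congr' ?_
    filter_upwards [eventually_ge_atTop p] with k hk
    exact (hy k (by simpa using hk)).symm
  have h1 := h.tendsto_sum (fracDiff_neg_mem_fracDomain hE hy0) n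
  rw [fracDiff_fracDiff_neg] at h1
  refine tendsto_nhds_unique h1 ?_
  refine (tendsto_finsetSum (Finset.range p) fun k _ =>
    (h.tendsto_sum_hatTerm_sub hE n k).mul_const (y k)).congr' ?_
  filter_upwards [eventually_ge_atTop p] with m hm
  refine Finset.sum_subset (Finset.range_mono hm) fun k _ hk => ?_
  rw [hy k hk, mul_zero]

theorem MatClass.exists_sum_norm_le (hE : null ≤ E) (h : MatClass α E F A) (n : ℕ) :
    ∃ C, ∀ m, ∑ k ∈ Finset.range m, ‖∑ i ∈ Finset.range (m - k), hatTerm α A n k i‖ ≤ C := by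
  refine exists_sum_norm_le_of_tendsto_on_null
    (w := fun m k => ∑ i ∈ Finset.range (m - k), hatTerm α A n k i) fun y hy => ?_
  have h1 := h.tendsto_sum (fracDiff_neg_mem_fracDomain hE hy) n
  rw [fracDiff_fracDiff_neg] at h1
  exact ⟨_, h1⟩

/-- The ℓ¹ bound on the triangular array passes to its entrywise limit on each finite section. -/
theorem MatClass.summable_norm_hat (hE : null ≤ E) (h : MatClass α E F A) (n : ℕ) :
    Summable fun k => ‖hat α A n k‖ := by
  obtain ⟨C, hC⟩ := h.exists_sum_norm_le hE n
  exact summable_of_sum_range_le (fun _ => norm_nonneg _)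
    (sum_norm_le_of_tendsto hC (h.tendsto_sum_hatTerm_sub hE n))

theorem exists_pos_forall_norm_le {x : ℕ → ℂ} (hx : x ∈ fracDomain α E) :
    ∃ M : ℝ, 0 < M ∧ ∀ k, ‖fracDiff α x k‖ ≤ M := by
  obtain ⟨M, hM⟩ := memℓp_infty_iff.1 hx.choose
  exact ⟨max M 1, by positivity, fun k => (hM ⟨k, rfl⟩).trans (le_max_left _ _)⟩

theorem MatClass.matApply_eq_tsum_null (h : MatClass α null F A) {x : ℕ → ℂ}
    (hx : x ∈ fracDomain α null) (n : ℕ) :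
    matApply A x n = ∑' k, hat α A n k * fracDiff α x k := by
  obtain ⟨C, hC⟩ := h.exists_sum_norm_le le_rfl n
  obtain ⟨M, -, hM⟩ := exists_pos_forall_norm_le hx
  exact tendsto_nhds_unique
    (tendsto_sum_range_of_tendsto_on_null hC (h.tendsto_sum_hatTerm_sub le_rfl n)
      ((mem_fracDomain_null α x).1 hx) (h.tendsto_sum hx n))
    (summable_mul_of_bounded (h.summable_norm_hat le_rfl n) hM).hasSum.tendsto_sum_nat

theorem MatClass.matApply_eq_tsum_linf (h : MatClass α linf F A) {x : ℕ → ℂ}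
    (hx : x ∈ fracDomain α linf) (n : ℕ) :
    matApply A x n = ∑' k, hat α A n k * fracDiff α x k := by
  have hE : null ≤ linf := le_top
  have hs := h.summable_norm_hat hE n
  -- Truncated subtraction makes the rows of `W` finitely supported, so they are in ℓ¹ and Schur's
  -- theorem applies to their differences from the row of Â.
  let W : ℕ → ℕ → ℂ := fun m k => ∑ i ∈ Finset.range (m - k), hatTerm α A n k i
  have hW0 : ∀ m, ∀ k ∉ Finset.range m, W m k = 0 := fun m k hk => by
    have : m - k = 0 := by simpa [Nat.sub_eq_zero_iff_le] using hk
    simp [W, this]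
  have hWs : ∀ m, Summable fun k => ‖W m k‖ := fun m =>
    summable_of_ne_finset_zero (s := Finset.range m) fun k hk => by rw [hW0 m k hk, norm_zero]
  have hus : ∀ m, Summable fun k => ‖W m k - hat α A n k‖ := fun m =>
    Summable.of_nonneg_of_le (fun _ => norm_nonneg _) (fun _ => norm_sub_le _ _) ((hWs m).add hs)
  have key : ∀ (y : ℕ → ℂ) (M : ℝ), (∀ k, ‖y k‖ ≤ M) →
      Tendsto (fun m => ∑' k, (W m k - hat α A n k) * y k) atTop
        (𝓝 (matApply A (fracDiff (-α) y) n - ∑' k, hat α A n k * y k)) := by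
    intro y M hy
    have hmem : fracDiff (-α) y ∈ fracDomain α linf := by
      rw [mem_fracDomain_linf, fracDiff_fracDiff_neg]
      exact ⟨M, by rintro _ ⟨k, rfl⟩; exact hy k⟩
    have h1 := h.tendsto_sum hmem n
    rw [fracDiff_fracDiff_neg] at h1
    refine (h1.sub_const _).congr fun m => ?_
    simp only [sub_mul]
    rw [(summable_mul_of_bounded (hWs m) hy).tsum_sub (summable_mul_of_bounded hs hy),
      tsum_eq_sum (f := fun k => W m k * y k) (s := Finset.range m)
        fun k hk => by rw [hW0 m k hk, zero_mul]]
  obtain ⟨M, hM0, hM⟩ := exists_pos_forall_norm_le hx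
  have h2 := key _ M hM
  rw [fracDiff_neg_fracDiff] at h2
  refine sub_eq_zero.1 (eq_zero_of_tendsto_tsum_mul_of_bounded hus (fun k => ?_)
    (fun y hy => ⟨_, key y 1 hy⟩) hM0 hM h2)
  simpa using (h.tendsto_sum_hatTerm_sub hE n k).sub_const (hat α A n k)

theorem MatClass.matApply_eq_tsum (hE : E = null ∨ E = linf) (h : MatClass α E F A) {x : ℕ → ℂ}
    (hx : x ∈ fracDomain α E) (n : ℕ) :
    matApply A x n = ∑' k, hat α A n k * fracDiff α x k := by
  rcases hE with rfl | rfl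
  · exact h.matApply_eq_tsum_null hx n
  · exact h.matApply_eq_tsum_linf hx n

end Rows

/-! ### Compactness -/

/-- An operator into the bounded sequences is compact if its coordinates converge in norm. -/
theorem isCompactOperator_of_tendsto_coord {X : Type*} [NormedAddCommGroup X] [NormedSpace ℂ X]
    (T : X →ₗ[ℂ] Bdd) (φ : ℕ → X →L[ℂ] ℂ) (ψ : X →L[ℂ] ℂ) (hT : ∀ x n, T x n = φ n x)
    (hφ : Tendsto φ atTop (𝓝 ψ)) : IsCompactOperator T := by
  obtain ⟨C, hC⟩ := hφ.norm.bddAbove_range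
  have hC' : ∀ n, ‖φ n‖ ≤ C := fun n => hC ⟨n, rfl⟩
  let T' : X →L[ℂ] Bdd := T.mkContinuous C fun x =>
    lp.norm_le_of_forall_le (mul_nonneg ((norm_nonneg (φ 0)).trans (hC' 0)) (norm_nonneg _))
      fun n => by
        rw [hT]
        exact (φ n).le_of_opNorm_le (hC' n) x
  let one : Bdd := ⟨fun _ => 1, memℓp_infty ⟨1, by rintro _ ⟨k, rfl⟩; simp⟩⟩
  -- The finite-rank operator that keeps the first r coordinates of `T` and replaces all later ones
  -- by the limit functional.
  let G : ℕ → X →L[ℂ] Bdd := fun r => ψ.smulRight one +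
    ∑ n ∈ Finset.range r, (φ n - ψ).smulRight (lp.single ∞ n (1 : ℂ))
  have hrank : ∀ (f : X →L[ℂ] ℂ) (b : Bdd), IsCompactOperator (f.smulRight b) := fun f b =>
    (isCompactOperator_of_locallyCompactSpace_dom f).clm_comp
      ((1 : ℂ →L[ℂ] ℂ).smulRight b)
  have hG : ∀ r, IsCompactOperator (G r) := fun r => by
    induction r with
    | zero => simpa [G] using hrank ψ one
    | succ r ih =>
      have : G (r + 1) = G r + (φ r - ψ).smulRight (lp.single ∞ r (1 : ℂ)) := by
        simp only [G, Finset.sum_range_succ, add_assoc]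
      rw [this]
      exact ih.add (hrank _ _)
  have hGapply : ∀ r x n, G r x n = if n < r then φ n x else ψ x := by
    intro r x n
    have h1 : G r x n = ψ x + ∑ j ∈ Finset.range r, (φ j x - ψ x) * (Pi.single j 1 : ℕ → ℂ) n := by
      have : coord n (G r x) = ψ x + ∑ j ∈ Finset.range r,
          (φ j x - ψ x) * (Pi.single j 1 : ℕ → ℂ) n := by
        simp only [G, add_apply, sum_apply,
          ContinuousLinearMap.smulRight_apply, map_add, map_sum, map_smul,
          sub_apply, coord_apply, lp.single_apply, smul_eq_mul]
        simp [one]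
      exact this
    rw [h1]
    simp only [Pi.single_apply, mul_ite, mul_one, mul_zero, Finset.sum_ite_eq, Finset.mem_range]
    split_ifs <;> ring
  have hlim : Tendsto G atTop (𝓝 T') := by
    rw [Metric.tendsto_atTop] at hφ ⊢
    intro ε hε
    obtain ⟨N, hN⟩ := hφ (ε / 2) (half_pos hε)
    refine ⟨N, fun r hr => ?_⟩
    rw [dist_eq_norm]
    refine lt_of_le_of_lt (ContinuousLinearMap.opNorm_le_bound _ (half_pos hε).le fun x => ?_)
      (half_lt_self hε)
    refine lp.norm_le_of_forall_le (by positivity) fun n => ?_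
    show ‖G r x n - T x n‖ ≤ _
    rw [hGapply, hT]
    split_ifs with hn
    · rw [sub_self, norm_zero]
      positivity
    · have := hN n (hr.trans (not_lt.1 hn))
      rw [dist_comm, dist_eq_norm] at this
      exact (ψ - φ n).le_of_opNorm_le this.le x
  exact isCompactOperator_of_tendsto hlim (Eventually.of_forall hG)

/-- The functional on bounded sequences defined by an absolutely summable sequence. -/
noncomputable def rowFunctional (v : ℕ → ℂ) (hv : Summable fun k => ‖v k‖) : Bdd →L[ℂ] ℂ :=
  LinearMap.mkContinuous
    { toFun := fun y => ∑' k, v k * y k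
      map_add' := fun y z => by
        have hb : ∀ (y : Bdd) k, ‖y k‖ ≤ ‖y‖ := lp.norm_apply_le_norm ENNReal.top_ne_zero
        rw [← (summable_mul_of_bounded hv (hb y)).tsum_add (summable_mul_of_bounded hv (hb z))]
        exact tsum_congr fun k => mul_add _ _ _
      map_smul' := fun c y => by
        rw [RingHom.id_apply, smul_eq_mul, ← tsum_mul_left]
        exact tsum_congr fun k => mul_left_comm _ _ _ } (∑' k, ‖v k‖)
    (fun y => by
      refine tsum_of_norm_bounded (hv.hasSum.mul_right ‖y‖) fun k => ?_
      rw [norm_mul]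
      exact mul_le_mul_of_nonneg_left (lp.norm_apply_le_norm ENNReal.top_ne_zero y k)
        (norm_nonneg _))

theorem rowFunctional_apply (v : ℕ → ℂ) (hv : Summable fun k => ‖v k‖) (y : Bdd) :
    rowFunctional v hv y = ∑' k, v k * y k := rfl

theorem norm_rowFunctional_sub_le {v w : ℕ → ℂ} (hv : Summable fun k => ‖v k‖)
    (hw : Summable fun k => ‖w k‖) :
    ‖rowFunctional v hv - rowFunctional w hw‖ ≤ ∑' k, ‖v k - w k‖ := by
  have hvw : Summable fun k => ‖v k - w k‖ :=
    Summable.of_nonneg_of_le (fun _ => norm_nonneg _) (fun _ => norm_sub_le _ _) (hv.add hw)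
  have : rowFunctional v hv - rowFunctional w hw = rowFunctional _ hvw := by
    ext y
    have hb : ∀ k, ‖y k‖ ≤ ‖y‖ := lp.norm_apply_le_norm ENNReal.top_ne_zero y
    rw [sub_apply, rowFunctional_apply, rowFunctional_apply,
      rowFunctional_apply,
      ← (summable_mul_of_bounded hv hb).tsum_sub (summable_mul_of_bounded hw hb)]
    exact tsum_congr fun k => (sub_mul _ _ _).symm
  rw [this]
  exact LinearMap.mkContinuous_norm_le _ (tsum_nonneg fun _ => norm_nonneg _) _

/-- The isometry `Δ^(α)` from `E(Δ^(α))` to the bounded sequences. -/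
noncomputable def diffL (α : ℝ) (E : Submodule ℂ Bdd) : FracSpace α E →L[ℂ] Bdd :=
  LinearMap.mkContinuous FracSpace.diff 1 fun x => (one_mul ‖x‖).symm.le

theorem tendsto_of_tendsto_iSup_ge {f : ℕ → ℝ≥0∞}
    (hf : Tendsto (fun r : ℕ => ⨆ n ≥ r, f n) atTop (𝓝 0)) : Tendsto f atTop (𝓝 0) :=
  tendsto_of_tendsto_of_tendsto_of_le_of_le tendsto_const_nhds hf (fun _ => zero_le)
    fun r => le_iSup₂ (f := fun n (_ : n ≥ r) => f n) r le_rfl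

theorem tsum_enorm_eq_ofReal {v : ℕ → ℂ} (hv : Summable fun k => ‖v k‖) :
    ∑' k, ‖v k‖ₑ = ENNReal.ofReal (∑' k, ‖v k‖) := by
  rw [ENNReal.ofReal_tsum_of_nonneg (fun _ => norm_nonneg _) hv]
  exact tsum_congr fun k => (ofReal_norm _).symm

theorem summable_norm_of_tsum_enorm_ne_top {v : ℕ → ℂ} (hv : ∑' k, ‖v k‖ₑ ≠ ∞) :
    Summable fun k => ‖v k‖ := by
  simpa using ENNReal.summable_toReal hv

theorem MatClass.isCompactOperator {α : ℝ} {E F : Submodule ℂ Bdd} {A : ℕ → ℕ → ℂ}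
    (hE : E = null ∨ E = linf) (hF : IsClosed (F : Set Bdd)) (h : MatClass α E F A) (g : ℕ → ℂ)
    (hg : Tendsto (fun r : ℕ => ⨆ n ≥ r, ∑' k, ‖hat α A n k - g k‖ₑ) atTop (𝓝 0)) :
    IsCompactOperator (matOp h) := by
  have hE' : null ≤ E := by
    rcases hE with rfl | rfl
    · exact le_rfl
    · exact le_top
  have hlim := tendsto_of_tendsto_iSup_ge hg
  have hs := h.summable_norm_hat hE'
  -- A single row of Â at finite ℓ¹ distance from `g` suffices, since the rows are in ℓ¹.
  have hgs : Summable fun k => ‖g k‖ := by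
    obtain ⟨n, hn⟩ := (hlim.eventually_lt_const ENNReal.zero_lt_top).exists
    refine Summable.of_nonneg_of_le (fun _ => norm_nonneg _) (fun k => ?_)
      ((hs n).add (summable_norm_of_tsum_enorm_ne_top hn.ne))
    have := norm_sub_le (hat α A n k) (hat α A n k - g k)
    rwa [sub_sub_cancel] at this
  have hds : ∀ n, Summable fun k => ‖hat α A n k - g k‖ := fun n =>
    Summable.of_nonneg_of_le (fun _ => norm_nonneg _) (fun _ => norm_sub_le _ _) ((hs n).add hgs)
  have hreal : Tendsto (fun n => ∑' k, ‖hat α A n k - g k‖) atTop (𝓝 0) := by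
    have := (ENNReal.tendsto_toReal ENNReal.zero_ne_top).comp hlim
    refine this.congr fun n => ?_
    rw [Function.comp_apply, tsum_enorm_eq_ofReal (hds n),
      ENNReal.toReal_ofReal (tsum_nonneg fun _ => norm_nonneg _)]
  have hrow : Tendsto (fun n => rowFunctional _ (hs n)) atTop (𝓝 (rowFunctional g hgs)) :=
    tendsto_iff_norm_sub_tendsto_zero.2 (squeeze_zero (fun _ => norm_nonneg _)
      (fun n => norm_rowFunctional_sub_le (hs n) hgs) hreal)
  have hcomp : Tendsto (fun n => (rowFunctional _ (hs n)).comp (diffL α E)) atTop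
      (𝓝 ((rowFunctional g hgs).comp (diffL α E))) :=
    (((ContinuousLinearMap.compL ℂ (FracSpace α E) Bdd ℂ).flip (diffL α E)).continuous.tendsto
      _).comp hrow
  -- Compactness is obtained in ℓ∞ first; closedness of `F` then permits restricting the codomain.
  have hT := isCompactOperator_of_tendsto_coord (F.subtype ∘ₗ matOp h)
    (fun n => (rowFunctional _ (hs n)).comp (diffL α E)) _
    (fun x n => h.matApply_eq_tsum hE x.seq_mem n) hcomp
  exact hT.codRestrict (fun x => (matOp h x).2) hF

/-- A finite ε/3-net reduces the uniform rate to finitely many convergent sequences. The Cauchy form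
avoids naming the limits, which depend on the sequence. -/
theorem exists_uniform_cauchy_of_isCompact {K : Set Bdd} (hK : IsCompact K)
    (hKc : ∀ z ∈ K, z ∈ conv) {ε : ℝ} (hε : 0 < ε) :
    ∃ r, ∀ z ∈ K, ∀ n ≥ r, ∀ m ≥ r, ‖z n - z m‖ ≤ ε := by
  obtain ⟨t, htK, htf, hcov⟩ := finite_cover_balls_of_compact hK (e := ε / 3) (by positivity)
  have hev : ∀ᶠ r in atTop, ∀ z ∈ t, ∀ n ≥ r, ∀ m ≥ r, ‖z n - z m‖ ≤ ε / 3 := by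
    rw [htf.eventually_all]
    intro z hz
    obtain ⟨l, hl⟩ : ∃ l, Tendsto (fun n => z n) atTop (𝓝 l) := hKc z (htK hz)
    obtain ⟨N, hN⟩ := Metric.cauchySeq_iff.1 hl.cauchySeq (ε / 3) (by positivity)
    filter_upwards [eventually_ge_atTop N] with r hr n hn m hm
    rw [← dist_eq_norm]
    exact (hN n (hr.trans hn) m (hr.trans hm)).le
  obtain ⟨r, hr⟩ := hev.exists
  refine ⟨r, fun z hz n hn m hm => ?_⟩
  obtain ⟨z', hz', hzz'⟩ := Set.mem_iUnion₂.1 (hcov hz)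
  rw [Metric.mem_ball, dist_eq_norm] at hzz'
  have hb : ∀ k, ‖z k - z' k‖ ≤ ‖z - z'‖ := lp.norm_apply_le_norm ENNReal.top_ne_zero (z - z')
  have h1 := hr z' hz' n hn m hm
  have e : z n - z m = (z n - z' n) + (z' n - z' m) - (z m - z' m) := by ring
  rw [e]
  linarith [norm_sub_le ((z n - z' n) + (z' n - z' m)) (z m - z' m),
    norm_add_le (z n - z' n) (z' n - z' m), hb n, hb m]

theorem MatClass.tendsto_of_isCompactOperator {α : ℝ} {E F : Submodule ℂ Bdd}
    {A : ℕ → ℕ → ℂ} (hE : null ≤ E) (hF : F ≤ conv) (h : MatClass α E F A) {g : ℕ → ℂ}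
    (hg : ∀ k, Tendsto (fun n => hat α A n k) atTop (𝓝 (g k)))
    (hc : IsCompactOperator (matOp h)) :
    Tendsto (fun r : ℕ => ⨆ n ≥ r, ∑' k, ‖hat α A n k - g k‖ₑ) atTop (𝓝 0) := by
  obtain ⟨K, hK, hKsub⟩ := hc.image_closedBall_subset_compact (f := matOp h) 1
  have hK' : IsCompact (Subtype.val '' K : Set Bdd) := hK.image continuous_subtype_val
  rw [ENNReal.tendsto_atTop_zero]
  intro ε hε
  obtain ⟨δ, hδ, hδε⟩ : ∃ δ : ℝ, 0 < δ ∧ ENNReal.ofReal δ ≤ ε := by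
    obtain ⟨δ, hδ, hδε⟩ := ENNReal.lt_iff_exists_nnreal_btwn.1 hε
    exact ⟨δ, by exact_mod_cast hδ, by simpa using hδε.le⟩
  obtain ⟨r, hr⟩ := exists_uniform_cauchy_of_isCompact hK'
    (by rintro _ ⟨z, -, rfl⟩; exact hF z.2) hδ
  refine ⟨r, fun s hs => iSup₂_le fun n hn => ?_⟩
  refine (ENNReal.tsum_le_of_sum_range_le fun p => ?_).trans hδε
  have hsum : ∑ k ∈ Finset.range p, ‖hat α A n k - g k‖ ≤ δ := by
    refine sum_norm_le_of_forall_norm_sum_mul_le fun y hy1 hy0 => ?_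
    have hyt : Tendsto y atTop (𝓝 0) := by
      refine tendsto_const_nhds.congr' ?_
      filter_upwards [eventually_ge_atTop p] with k hk
      exact (hy0 k (by simpa using hk)).symm
    -- The preimage of the test sequence lies in the unit ball, so its image under L_A lies in the
    -- compact set.
    let x : FracSpace α E := ⟨fracDiff (-α) y, fracDiff_neg_mem_fracDomain hE hyt⟩
    have hx : ‖x‖ ≤ 1 := by
      rw [FracSpace.norm_eq]
      refine ciSup_le fun k => ?_
      show ‖fracDiff α (fracDiff (-α) y) k‖ ≤ 1
      rw [fracDiff_fracDiff_neg]
      exact hy1 k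
    have hxK : (matOp h x : Bdd) ∈ (Subtype.val '' K : Set Bdd) :=
      ⟨_, hKsub ⟨x, mem_closedBall_zero_iff.2 hx, rfl⟩, rfl⟩
    have hval : ∀ m, (matOp h x : Bdd) m = ∑ k ∈ Finset.range p, hat α A m k * y k := fun m =>
      h.matApply_of_support hE m p hy0
    -- The Cauchy estimate compares the rows n and m; letting m → ∞ in this finite sum replaces row
    -- m by `g`.
    have hlim : Tendsto (fun m => ‖∑ k ∈ Finset.range p, hat α A n k * y k
        - ∑ k ∈ Finset.range p, hat α A m k * y k‖) atTop
        (𝓝 ‖∑ k ∈ Finset.range p, hat α A n k * y k - ∑ k ∈ Finset.range p, g k * y k‖) :=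
      (tendsto_const_nhds.sub
        (tendsto_finsetSum _ fun k _ => (hg k).mul_const (y k))).norm
    simp only [sub_mul, Finset.sum_sub_distrib]
    refine le_of_tendsto hlim ?_
    filter_upwards [eventually_ge_atTop r] with m hm
    rw [← hval, ← hval]
    exact hr _ hxK n (hs.trans hn) m hm
  calc ∑ k ∈ Finset.range p, ‖hat α A n k - g k‖ₑ
      = ENNReal.ofReal (∑ k ∈ Finset.range p, ‖hat α A n k - g k‖) := by
        rw [ENNReal.ofReal_sum_of_nonneg fun _ _ => norm_nonneg _]
        exact Finset.sum_congr rfl fun k _ => (ofReal_norm _).symm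
    _ ≤ ENNReal.ofReal δ := ENNReal.ofReal_le_ofReal hsum

theorem MatClass.tendsto_hat_null {α : ℝ} {E : Submodule ℂ Bdd} {A : ℕ → ℕ → ℂ}
    (hE : null ≤ E) (h : MatClass α E null A) (k : ℕ) :
    Tendsto (fun n => hat α A n k) atTop (𝓝 0) := by
  simp only [h.hat_eq hE]
  exact (h _ (fracDiff_neg_mem_fracDomain hE (tendsto_single k 1))).2.choose_spec

theorem MatClass.tendsto_hat_hatLim {α : ℝ} {E : Submodule ℂ Bdd} {A : ℕ → ℕ → ℂ}
    (hE : null ≤ E) (h : MatClass α E conv A) (k : ℕ) :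
    Tendsto (fun n => hat α A n k) atTop (𝓝 (hatLim α A k)) := by
  apply tendsto_nhds_limUnder
  simp only [h.hat_eq hE]
  exact (h _ (fracDiff_neg_mem_fracDomain hE (tendsto_single k 1))).2.choose_spec

end FracDiff

theorem mainTheorem2 (α : ℝ) (E : Submodule ℂ FracDiff.Bdd)
    (hE : E = FracDiff.null ∨ E = FracDiff.linf) (A : ℕ → ℕ → ℂ) :
    (∀ h : FracDiff.MatClass α E FracDiff.null A,
      FracDiff.HatConverges α A ∧
      (IsCompactOperator (FracDiff.matOp h) ↔
        Tendsto (fun r : ℕ => ⨆ n ≥ r, ∑' k, ‖FracDiff.hat α A n k‖ₑ) atTop (𝓝 0))) ∧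
    (∀ h : FracDiff.MatClass α E FracDiff.conv A,
      FracDiff.HatConverges α A ∧
      (∀ k, Tendsto (fun n => FracDiff.hat α A n k) atTop (𝓝 (FracDiff.hatLim α A k))) ∧
      (IsCompactOperator (FracDiff.matOp h) ↔
        Tendsto (fun r : ℕ => ⨆ n ≥ r,
          ∑' k, ‖FracDiff.hat α A n k - FracDiff.hatLim α A k‖ₑ) atTop (𝓝 0))) ∧
    (∀ h : FracDiff.MatClass α E FracDiff.linf A,
      FracDiff.HatConverges α A ∧
      (Tendsto (fun r : ℕ => ⨆ n ≥ r, ∑' k, ‖FracDiff.hat α A n k‖ₑ) atTop (𝓝 0) →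
        IsCompactOperator (FracDiff.matOp h))) := by
  have hE' : FracDiff.null ≤ E := by
    rcases hE with rfl | rfl
    · exact le_rfl
    · exact le_top
  refine ⟨fun h => ⟨h.hatConverges hE', fun hc => ?_, fun ht => ?_⟩,
    fun h => ⟨h.hatConverges hE', h.tendsto_hat_hatLim hE', fun hc => ?_, fun ht => ?_⟩,
    fun h => ⟨h.hatConverges hE', fun ht => ?_⟩⟩
  · simpa using h.tendsto_of_isCompactOperator hE' FracDiff.null_le_conv (g := fun _ => 0)
      (h.tendsto_hat_null hE') hc
  · exact h.isCompactOperator hE FracDiff.isClosed_null (fun _ => 0) (by simpa using ht)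
  · exact h.tendsto_of_isCompactOperator hE' le_rfl (h.tendsto_hat_hatLim hE') hc
  · exact h.isCompactOperator hE FracDiff.isClosed_conv _ ht
  · exact h.isCompactOperator hE isClosed_univ (fun _ => 0) (by simpa using ht)
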